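/- Let $C\subset\mathbb C^n$ be a complex affine algebraic curve, that is, the set of common zeros of a family of polynomials such that the ring of polynomial functions on $C$ has Krull dimension $1$ ($C$ may be singular or reducible). Let $z:\mathbb C^n\to\mathbb C$ be a $\mathbb C$-linear map whose restriction $z|_C:C\to\mathbb C$ is proper. Then there is an integer $d>0$, depending only on $C$ and $z$, with the following property. Let $y:\mathbb C^n\to\mathbb C$ be a polynomial and let $\gamma:[0,\infty)\to C$ be a proper continuous map such that $y\circ\gamma$ does not vanish identically on any interval $[T,\infty)$. Then $y(\gamma(t))\neq 0$ and $|z(\gamma(t))|>1$ for all sufficiently large $t$, and there are integers $a,b$ with $0<|a|\le d$ such that $$\lim_{t\to\infty}\frac{\log|y(\gamma(t))|}{\log|z(\gamma(t))|}=\frac ba .$$ -/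

import Mathlib

open Filter Topology
open scoped NNReal

/-- A complex affine algebraic curve in `ℂⁿ`: the set of common zeros of a family of polynomials,
whose coordinate ring (polynomials modulo those vanishing on `C`) has Krull dimension one.
It may be singular, reducible or disconnected. -/
def IsAffineAlgebraicCurve {n : ℕ} (C : Set (Fin n → ℂ)) : Prop :=
  (∃ I : Ideal (MvPolynomial (Fin n) ℂ), C = MvPolynomial.zeroLocus ℂ I) ∧
    ringKrullDim (MvPolynomial (Fin n) ℂ ⧸ MvPolynomial.vanishingIdeal ℂ C) = 1

universe u v

/-! The coordinate ring of C has dimension one, so it is algebraic over the polynomials in z, of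
finite generic rank d. Hence each y satisfies P(z, y) = 0 on C with P ≠ 0 of degree at most d in y
(`IsAffineAlgebraicCurve.exists_forall_exists_relation`). Along γ, |z| → ∞. Among the terms a_i(z)
y^i of this vanishing sum two have comparable size, and |a_i(z)| is comparable to |z|^(deg a_i). So
log|y| / log|z| approaches the finite set of Newton slopes (deg a_i - deg a_j) / (j - i), and by
continuity it converges to one of them (`Polynomial.exists_tendsto_log_norm_div_log_norm`). As C may
be reducible, y may vanish on some components; dividing P by its largest power of y shows that γ
eventually avoids the zeros of y or stays among them. -/

/-! ### Dimension one and algebraic relations of bounded degree -/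

open Polynomial in
/-- An algebraic algebra of finite type over a domain has generically finite rank, so its elements
satisfy nonzero polynomial relations of bounded degree. -/
theorem exists_forall_exists_natDegree_le_aeval_eq_zero (R : Type u) (A : Type v) [CommRing R] [IsDomain R]
    [CommRing A] [Algebra R A] [Algebra.FiniteType R A] [Algebra.IsAlgebraic R A] :
    ∃ d : ℕ, ∀ y : A, ∃ P : R[X], P ≠ 0 ∧ P.natDegree ≤ d ∧ aeval y P = 0 := by
  let K := FractionRing R
  have hint : Algebra.IsIntegral K (TensorProduct R K A) := by
    refine ⟨fun x => ?_⟩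
    induction x with
    | zero => exact isIntegral_zero
    | add x y hx hy => exact hx.add hy
    | tmul c a =>
      have h1 : IsAlgebraic R (1 ⊗ₜ[R] a : TensorProduct R K A) :=
        (Algebra.IsAlgebraic.isAlgebraic (R := R) a).algHom
          (Algebra.TensorProduct.includeRight : A →ₐ[R] TensorProduct R K A)
      have h2 : IsAlgebraic K (1 ⊗ₜ[R] a : TensorProduct R K A) := h1.extendScalars
        (FaithfulSMul.algebraMap_injective R K)
      have h3 := h2.isIntegral.smul c
      rwa [TensorProduct.smul_tmul', smul_eq_mul, mul_one] at h3
  have hfin : Module.Finite K (TensorProduct R K A) := Algebra.IsIntegral.finite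
  refine ⟨Module.finrank K (TensorProduct R K A), fun y => ?_⟩
  -- Base change to K preserves rank, even if A has torsion, so one more power of y than this rank
  -- must be dependent over R itself.
  have hdep : ¬ LinearIndependent R
      (fun i : Fin (Module.finrank K (TensorProduct R K A) + 1) => y ^ (i : ℕ)) := by
    intro h
    have h1 := Cardinal.lift_le.{max u v}.mpr h.cardinal_lift_le_rank
    have h2 := (TensorProduct.isBaseChange R A K).lift_rank_eq
    rw [← Module.finrank_eq_rank K] at h2
    rw [Cardinal.lift_natCast] at h2
    simp only [Cardinal.mk_fin, Cardinal.lift_natCast, Cardinal.lift_id'.{0, v}] at h1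
    rw [← h2, Nat.cast_le] at h1
    omega
  rw [Fintype.not_linearIndependent_iff] at hdep
  obtain ⟨g, hg, i, hi⟩ := hdep
  refine ⟨∑ j, C (g j) * X ^ (j : ℕ), fun h0 => hi ?_, ?_, ?_⟩
  · have := congrArg (fun q => q.coeff (i : ℕ)) h0
    simpa [Polynomial.coeff_C_mul, Polynomial.coeff_X_pow, Fin.val_inj] using this
  · refine natDegree_sum_le_of_forall_le _ _ fun j _ => ?_
    exact (natDegree_C_mul_X_pow_le _ _).trans (Nat.lt_succ_iff.mp j.2)
  · simpa [Algebra.smul_def] using hg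

/-- Going up lifts a chain of primes, starting from a prime over its smallest member. -/
theorem ringKrullDim_le_of_isIntegral (R S : Type*) [CommRing R] [CommRing S] [Algebra R S]
    [Algebra.IsIntegral R S] [FaithfulSMul R S] : ringKrullDim R ≤ ringKrullDim S := by
  refine iSup_le fun l => ?_
  obtain ⟨P, hP, hPo⟩ := (Ideal.nonempty_primesOver (S := S) l.head.asIdeal).some
  obtain ⟨L, hL, -⟩ := Ideal.exists_ltSeries_of_hasGoingUp l P
  rw [← hL]
  exact le_iSup (fun L : LTSeries (PrimeSpectrum S) => ((L.length : ℕ∞) : WithBot ℕ∞)) L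

-- A transcendental w would embed a polynomial ring in two variables into A. Some minimal prime p
-- contracts to zero there, so the embedding persists in the domain A/p, whose transcendence degree
-- is at most 1 by Noether normalization of A.
open Polynomial in
theorem isAlgebraic_of_ringKrullDim_le_one {k A : Type u} [Field k] [CommRing A] [Algebra k A]
    [Algebra.FiniteType k A] [Algebra k[X] A] [IsScalarTower k k[X] A]
    (h : ringKrullDim A ≤ 1) : Algebra.IsAlgebraic k[X] A := by
  refine ⟨fun w => ?_⟩
  by_contra hw
  have hinj : Function.Injective (aeval (R := k[X]) w) := transcendental_iff_injective.mp hw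
  have : Nontrivial A := hinj.nontrivial
  obtain ⟨p, hp, hpc⟩ := Ideal.exists_comap_eq_of_mem_minimalPrimes_of_injective
    (f := (aeval (R := k[X]) w).toRingHom) hinj ⊥ (by simp [IsDomain.minimalPrimes_eq_singleton_bot])
  obtain ⟨s, g, hg, hgi⟩ := exists_integral_inj_algHom_of_fg k A
  have hs : s ≤ 1 := by
    algebraize [g.toRingHom]
    have : Algebra.IsIntegral (MvPolynomial (Fin s) k) A := ⟨hgi⟩
    have : FaithfulSMul (MvPolynomial (Fin s) k) A := (faithfulSMul_iff_algebraMap_injective _ _).mpr hg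
    have h1 := (ringKrullDim_le_of_isIntegral (MvPolynomial (Fin s) k) A).trans h
    rw [MvPolynomial.ringKrullDim_of_isNoetherianRing] at h1
    simp at h1
    exact_mod_cast h1
  have h1 : Algebra.trdeg k (A ⧸ p) ≤ 1 := by
    let gb : MvPolynomial (Fin s) k →ₐ[k] (A ⧸ p) := (Ideal.Quotient.mkₐ k p).comp g
    have hr : Algebra.adjoin k (Set.range fun i => gb (MvPolynomial.X i)) = gb.range := by
      rw [Algebra.adjoin_range_eq_range_aeval]
      congr 1
      ext i
      simp
    have : Algebra.IsAlgebraic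
        (Algebra.adjoin k (Set.range fun i => gb (MvPolynomial.X i))) (A ⧸ p) := by
      have h3 : gb.toRingHom.IsIntegral :=
        hgi.trans _ _ (RingHom.isIntegral_of_surjective _ Ideal.Quotient.mk_surjective)
      refine ⟨fun b => ?_⟩
      refine IsIntegral.isAlgebraic ?_
      obtain ⟨q, hq, hq0⟩ := h3 b
      rw [hr]
      refine ⟨q.map gb.rangeRestrict.toRingHom, hq.map _, ?_⟩
      rw [eval₂_map]
      exact hq0
    refine (Algebra.IsAlgebraic.trdeg_le_cardinalMk k
      (Set.range fun i => gb (MvPolynomial.X i))).trans ?_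
    rw [← Cardinal.lift_le.{0}]
    refine Cardinal.mk_range_le_lift.trans ?_
    simpa using hs
  have h2 : Algebra.trdeg k k[X][X] ≤ Algebra.trdeg k (A ⧸ p) := by
    refine trdeg_le_of_injective
      ((Ideal.Quotient.mkₐ k p).comp ((aeval (R := k[X]) w).restrictScalars k)) ?_
    rw [injective_iff_map_eq_zero]
    intro q hq
    have : q ∈ p.comap (aeval (R := k[X]) w).toRingHom := by
      simpa [Ideal.Quotient.eq_zero_iff_mem] using hq
    rw [hpc] at this
    simpa using this
  rw [← trdeg_add_eq (A := k[X][X]) k k[X], Polynomial.trdeg_of_isDomain,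
    Polynomial.trdeg_of_isDomain, one_add_one_eq_two] at h2
  exact absurd (h2.trans h1) (by norm_num)

/-! ### Connectedness of the half-line -/

/-- A continuous real function on a half-line that approaches a finite set converges to one of its
points. -/
theorem exists_tendsto_of_forall_eventually_exists_abs_sub_lt {u : ℝ≥0 → ℝ} {T : ℝ≥0}
    (hu : ContinuousOn u (Set.Ici T)) (F : Finset ℝ)
    (h : ∀ ε > 0, ∀ᶠ t in atTop, ∃ r ∈ F, |u t - r| < ε) :
    ∃ r ∈ F, Tendsto u atTop (𝓝 r) := by
  obtain ⟨δ, hδ, hsep⟩ : ∃ δ > 0, ∀ r ∈ F, ∀ s ∈ F, r ≠ s → 2 * δ ≤ |r - s| := by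
    have h1 : ∀ p ∈ F.offDiag, ∀ᶠ δ in 𝓝[>] (0 : ℝ), 2 * δ ≤ |p.1 - p.2| := by
      intro p hp
      have hpos : 0 < |p.1 - p.2| := abs_pos.mpr (sub_ne_zero.mpr (Finset.mem_offDiag.mp hp).2.2)
      filter_upwards [Ioo_mem_nhdsGT (half_pos hpos)] with δ hδ
      linarith [hδ.2]
    obtain ⟨δ, hδ, hδ0⟩ := ((F.offDiag.eventually_all.mpr h1).and self_mem_nhdsWithin).exists
    exact ⟨δ, hδ0, fun r hr s hs hrs => hδ (r, s) (Finset.mem_offDiag.mpr ⟨hr, hs, hrs⟩)⟩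
  obtain ⟨T₀, hT₀⟩ := eventually_atTop.mp ((h δ hδ).and (eventually_ge_atTop T))
  obtain ⟨r, hr, hrT⟩ := (hT₀ T₀ le_rfl).1
  -- The δ-balls around the points of F are disjoint, so the connected image stays in the one around
  -- r.
  have hpre : IsPreconnected (u '' Set.Ici T₀) :=
    isPreconnected_Ici.image _ (hu.mono (Set.Ici_subset_Ici.mpr (hT₀ T₀ le_rfl).2))
  have hsub : u '' Set.Ici T₀ ⊆ Metric.ball r δ := by
    refine hpre.subset_left_of_subset_union (v := ⋃ s ∈ F.erase r, Metric.ball s δ)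
      Metric.isOpen_ball (isOpen_biUnion fun _ _ => Metric.isOpen_ball) ?_ ?_ ?_
    · rw [Set.disjoint_iUnion₂_right]
      intro s hs
      refine Metric.ball_disjoint_ball ?_
      rw [Real.dist_eq]
      linarith [hsep r hr s (Finset.mem_of_mem_erase hs) (Finset.ne_of_mem_erase hs).symm]
    · rintro _ ⟨t, ht, rfl⟩
      obtain ⟨s, hs, hst⟩ := (hT₀ t ht).1
      rcases eq_or_ne s r with rfl | hsr
      · exact Or.inl hst
      · exact Or.inr (Set.mem_biUnion (Finset.mem_coe.mpr (Finset.mem_erase.mpr ⟨hsr, hs⟩)) hst)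
    · exact ⟨u T₀, ⟨T₀, Set.self_mem_Ici, rfl⟩, hrT⟩
  refine ⟨r, hr, Metric.tendsto_nhds.mpr fun ε hε => ?_⟩
  filter_upwards [h (min ε δ) (lt_min hε hδ), eventually_ge_atTop T₀] with t ⟨s, hs, hst⟩ ht
  have h1 : |u t - r| < δ := hsub ⟨t, ht, rfl⟩
  rcases eq_or_ne r s with rfl | hrs
  · exact hst.trans_le (min_le_left _ _)
  · have h2 := hsep r hr s hs hrs
    have h3 := abs_sub_le r (u t) s
    rw [abs_sub_comm r (u t)] at h3
    linarith [hst.trans_le (min_le_right _ _)]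

/-- On a half-line, if one of two closed conditions holds at each point but never both,
then one of them holds throughout. -/
theorem eventually_or_eventually_of_continuousOn {f g : ℝ≥0 → ℂ} (hf : Continuous f)
    (hg : Continuous g) (h : ∀ᶠ t in atTop, f t = 0 ∨ g t = 0)
    (hfg : ∀ᶠ t in atTop, ¬ (f t = 0 ∧ g t = 0)) :
    (∀ᶠ t in atTop, f t = 0) ∨ (∀ᶠ t in atTop, g t = 0) := by
  obtain ⟨T, hT⟩ := eventually_atTop.mp (h.and hfg)
  have := isPreconnected_iff_subset_of_disjoint_closed.mp (isPreconnected_Ici (a := T))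
    (f ⁻¹' {0}) (g ⁻¹' {0}) (isClosed_singleton.preimage hf) (isClosed_singleton.preimage hg)
    (fun t ht => (hT t ht).1)
    (Set.eq_empty_of_forall_notMem fun t ht => (hT t ht.1).2 ht.2)
  refine this.imp ?_ ?_ <;> exact fun hs => (eventually_ge_atTop T).mono fun t ht => hs ht

/-! ### Growth of roots and Newton slopes -/

-- a(z) is z^(deg a) times the reversed polynomial at 1/z, which tends to the nonzero leading
-- coefficient.
open Polynomial in
theorem Polynomial.exists_eventually_abs_log_norm_eval_sub_le {a : ℂ[X]} (ha : a ≠ 0) {z : ℝ≥0 → ℂ}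
    (hz : Tendsto (fun t => ‖z t‖) atTop atTop) :
    ∃ B : ℝ, ∀ᶠ t in atTop, a.eval (z t) ≠ 0 ∧
      |Real.log ‖a.eval (z t)‖ - a.natDegree * Real.log ‖z t‖| ≤ B := by
  have hz' : Tendsto z atTop (Bornology.cobounded ℂ) := tendsto_norm_atTop_iff_cobounded.mp hz
  have hrev : Tendsto (fun t => a.reverse.eval (z t)⁻¹) atTop (𝓝 a.leadingCoeff) := by
    have h1 := (a.reverse.continuous.tendsto 0).comp (tendsto_inv₀_cobounded.comp hz')
    simpa [← coeff_zero_eq_eval_zero, Function.comp_def] using h1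
  have hlc : a.leadingCoeff ≠ 0 := leadingCoeff_ne_zero.mpr ha
  have hlog := (hrev.norm.log (norm_ne_zero_iff.mpr hlc)).sub_const (Real.log ‖a.leadingCoeff‖)
  rw [sub_self] at hlog
  refine ⟨|Real.log ‖a.leadingCoeff‖| + 1, ?_⟩
  filter_upwards [hrev.eventually_ne hlc, hz.eventually_gt_atTop 0,
    hlog.eventually (Metric.ball_mem_nhds 0 one_pos)] with t h1 h2 h3
  have hzt : z t ≠ 0 := norm_pos_iff.mp h2
  have key : a.eval (z t) = a.reverse.eval (z t)⁻¹ * z t ^ a.natDegree := by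
    let := invertibleOfNonzero hzt
    simpa [eval₂_id] using (eval₂_reverse_mul_pow (RingHom.id ℂ) (z t) a).symm
  have h4 : a.eval (z t) ≠ 0 := key ▸ mul_ne_zero h1 (pow_ne_zero _ hzt)
  refine ⟨h4, ?_⟩
  rw [key, norm_mul, norm_pow, Real.log_mul (norm_ne_zero_iff.mpr h1) (pow_ne_zero _ h2.ne'),
    Real.log_pow, add_sub_cancel_right]
  have h5 := abs_sub_abs_le_abs_sub (Real.log ‖a.reverse.eval (z t)⁻¹‖) (Real.log ‖a.leadingCoeff‖)
  replace h3 : dist _ _ < _ := h3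
  rw [Real.dist_0_eq_abs] at h3
  linarith

/-- In a vanishing sum of nonzero complex numbers, two terms have comparable size. -/
theorem exists_ne_abs_log_norm_sub_le {ι : Type*} {S : Finset ι} (hS : S.Nonempty) {c : ι → ℂ}
    (hc : ∀ i ∈ S, c i ≠ 0) (hsum : ∑ i ∈ S, c i = 0) :
    ∃ i ∈ S, ∃ j ∈ S, i ≠ j ∧ |Real.log ‖c i‖ - Real.log ‖c j‖| ≤ Real.log S.card := by
  classical
  -- Take the largest and second largest terms: the former is minus the sum of the others.
  obtain ⟨i, hi, hmax⟩ := S.exists_max_image (fun i => ‖c i‖) hS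
  have hne : (S.erase i).Nonempty := by
    by_contra h
    rw [← Finset.add_sum_erase S c hi, Finset.not_nonempty_iff_eq_empty.mp h] at hsum
    exact hc i hi (by simpa using hsum)
  obtain ⟨j, hj, hjmax⟩ := (S.erase i).exists_max_image (fun i => ‖c i‖) hne
  have hjS := Finset.mem_of_mem_erase hj
  refine ⟨i, hi, j, hjS, (Finset.ne_of_mem_erase hj).symm, ?_⟩
  have hci := norm_pos_iff.mpr (hc i hi)
  have hcj := norm_pos_iff.mpr (hc j hjS)
  have hle : ‖c i‖ ≤ S.card * ‖c j‖ := by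
    rw [← Finset.add_sum_erase S c hi, add_eq_zero_iff_eq_neg] at hsum
    rw [hsum, norm_neg]
    refine (norm_sum_le_of_le _ hjmax).trans ?_
    rw [Finset.sum_const, nsmul_eq_mul]
    have := Finset.card_erase_le (s := S) (a := i)
    gcongr
  rw [abs_of_nonneg (sub_nonneg.mpr (Real.log_le_log hcj (hmax j hjS))), sub_le_iff_le_add,
    ← Real.log_mul (Nat.cast_ne_zero.mpr hS.card_pos.ne') hcj.ne']
  exact Real.log_le_log hci hle

open Polynomial in
/-- The order of growth of a nonvanishing root of a polynomial with polynomial coefficients is a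
slope of its Newton polygon. -/
theorem Polynomial.exists_tendsto_log_norm_div_log_norm {Q : ℂ[X][X]} (hQ : Q ≠ 0) {z y : ℝ≥0 → ℂ}
    (hzc : Continuous z) (hyc : Continuous y) (hz : Tendsto (fun t => ‖z t‖) atTop atTop)
    (hy : ∀ᶠ t in atTop, y t ≠ 0)
    (h : ∀ᶠ t in atTop, (Q.map (evalRingHom (z t))).eval (y t) = 0) :
    ∃ a b : ℤ, a ≠ 0 ∧ |a| ≤ Q.natDegree ∧
      Tendsto (fun t => Real.log ‖y t‖ / Real.log ‖z t‖) atTop (𝓝 ((b : ℝ) / (a : ℝ))) := by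
  have hL : Tendsto (fun t => Real.log ‖z t‖) atTop atTop := Real.tendsto_log_atTop.comp hz
  have hcoef : ∀ i ∈ Q.support, ∃ B : ℝ, ∀ᶠ t in atTop, (Q.coeff i).eval (z t) ≠ 0 ∧
      |Real.log ‖(Q.coeff i).eval (z t)‖ - (Q.coeff i).natDegree * Real.log ‖z t‖| ≤ B :=
    fun i hi => exists_eventually_abs_log_norm_eval_sub_le (mem_support_iff.mp hi) hz
  choose! B hB using hcoef
  set m : ℕ → ℕ := fun i => (Q.coeff i).natDegree with hm
  -- Comparable terms i and j give (j - i) log|y| = (m i - m j) log|z| + O(1). The bound M allows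
  -- one coefficient error for each term.
  let slope : ℕ × ℕ → ℝ := fun p => (((m p.1 : ℤ) - m p.2 : ℤ) : ℝ) / (((p.2 : ℤ) - p.1 : ℤ) : ℝ)
  let M : ℝ := Real.log Q.support.card + ∑ i ∈ Q.support, |B i| + ∑ i ∈ Q.support, |B i|
  have hclose : ∀ᶠ t in atTop, ∃ p ∈ Q.support.offDiag,
      |Real.log ‖y t‖ / Real.log ‖z t‖ - slope p| ≤ M / Real.log ‖z t‖ := by
    filter_upwards [hy, h, hL.eventually_gt_atTop 0, Q.support.eventually_all.mpr hB]
      with t hyt ht hLt hBt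
    have hsum : ∑ i ∈ Q.support, (Q.coeff i).eval (z t) * y t ^ i = 0 := by
      rw [eval_map, eval₂_eq_sum, Polynomial.sum] at ht
      simpa using ht
    obtain ⟨i, hi, j, hj, hij, hlog⟩ := exists_ne_abs_log_norm_sub_le
      (support_nonempty.mpr hQ) (fun i hi => mul_ne_zero (hBt i hi).1 (pow_ne_zero i hyt)) hsum
    refine ⟨(i, j), Finset.mem_offDiag.mpr ⟨hi, hj, hij⟩, ?_⟩
    have hlogmul : ∀ k ∈ Q.support, Real.log ‖(Q.coeff k).eval (z t) * y t ^ k‖ =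
        Real.log ‖(Q.coeff k).eval (z t)‖ + k * Real.log ‖y t‖ := by
      intro k hk
      rw [norm_mul, norm_pow, Real.log_mul (norm_ne_zero_iff.mpr (hBt k hk).1)
        (pow_ne_zero _ (norm_ne_zero_iff.mpr hyt)), Real.log_pow]
    rw [hlogmul i hi, hlogmul j hj] at hlog
    have hBle : ∀ k ∈ Q.support, B k ≤ ∑ i ∈ Q.support, |B i| := fun k hk =>
      (le_abs_self _).trans (Finset.single_le_sum (f := fun i => |B i|) (fun _ _ => abs_nonneg _) hk)
    have h1 := (hBt i hi).2.trans (hBle i hi)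
    have h2 := (hBt j hj).2.trans (hBle j hj)
    have hji : ((j : ℝ) - i) ≠ 0 := sub_ne_zero.mpr (Nat.cast_injective.ne hij.symm)
    have hji1 : 1 ≤ |(j : ℝ) - i| := by
      have : (1 : ℤ) ≤ |(j : ℤ) - i| := Int.one_le_abs (sub_ne_zero.mpr (by exact_mod_cast hij.symm))
      exact_mod_cast this
    have hnum : |((j : ℝ) - i) * Real.log ‖y t‖ - ((m i : ℝ) - m j) * Real.log ‖z t‖| ≤ M := by
      simp only [M, abs_le] at *
      constructor <;> linarith [hlog.1, hlog.2, h1.1, h1.2, h2.1, h2.2]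
    have heq : Real.log ‖y t‖ / Real.log ‖z t‖ - slope (i, j) =
        (((j : ℝ) - i) * Real.log ‖y t‖ - ((m i : ℝ) - m j) * Real.log ‖z t‖) /
          (((j : ℝ) - i) * Real.log ‖z t‖) := by
      simp only [slope]
      push_cast
      field_simp
    rw [heq, abs_div, abs_mul, abs_of_pos hLt]
    have hM : 0 ≤ M := (abs_nonneg _).trans hnum
    gcongr
    exact le_mul_of_one_le_left hLt.le hji1
  obtain ⟨T, hT⟩ := eventually_atTop.mp (hy.and (hz.eventually_gt_atTop 1))
  have hcont : ContinuousOn (fun t => Real.log ‖y t‖ / Real.log ‖z t‖) (Set.Ici T) := by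
    refine ContinuousOn.div ?_ ?_ ?_
    · exact hyc.norm.continuousOn.log fun t ht => norm_ne_zero_iff.mpr (hT t ht).1
    · exact hzc.norm.continuousOn.log fun t ht => (one_pos.trans (hT t ht).2).ne'
    · exact fun t ht => (Real.log_pos (hT t ht).2).ne'
  obtain ⟨r, hr, hlim⟩ := exists_tendsto_of_forall_eventually_exists_abs_sub_lt hcont
    (Q.support.offDiag.image slope) (by
      intro ε hε
      filter_upwards [hclose, (hL.const_div_atTop M).eventually (gt_mem_nhds hε)]
        with t ⟨p, hp, hpt⟩ hMt
      exact ⟨slope p, Finset.mem_image_of_mem _ hp, hpt.trans_lt hMt⟩)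
  obtain ⟨p, hp, rfl⟩ := Finset.mem_image.mp hr
  obtain ⟨hp1, hp2, hp12⟩ := Finset.mem_offDiag.mp hp
  have h1 := le_natDegree_of_mem_supp _ hp1
  have h2 := le_natDegree_of_mem_supp _ hp2
  refine ⟨(p.2 : ℤ) - p.1, (m p.1 : ℤ) - m p.2, by omega, ?_, hlim⟩
  rw [abs_le]
  omega

/-! ### Application to the curve -/

open Polynomial in
/-- Regular functions on an algebraic curve satisfy polynomial relations of bounded degree over the
polynomials in a fixed regular function. -/
theorem IsAffineAlgebraicCurve.exists_forall_exists_relation {n : ℕ} {C : Set (Fin n → ℂ)}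
    (hC : IsAffineAlgebraicCurve C) (f : MvPolynomial (Fin n) ℂ) :
    ∃ d : ℕ, ∀ y : MvPolynomial (Fin n) ℂ, ∃ P : ℂ[X][X], P ≠ 0 ∧ P.natDegree ≤ d ∧
      ∀ x ∈ C, (P.map (evalRingHom (MvPolynomial.eval x f))).eval (MvPolynomial.eval x y) = 0 := by
  let I := MvPolynomial.vanishingIdeal ℂ C
  let A := MvPolynomial (Fin n) ℂ ⧸ I
  let : Algebra ℂ[X] A := (aeval (Ideal.Quotient.mk I f)).toAlgebra
  have : IsScalarTower ℂ ℂ[X] A := .of_algebraMap_eq fun c =>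
    (aeval_C (Ideal.Quotient.mk I f) c).symm
  have : Algebra.IsAlgebraic ℂ[X] A := isAlgebraic_of_ringKrullDim_le_one hC.2.le
  have : Algebra.FiniteType ℂ[X] A := .of_restrictScalars_finiteType ℂ ℂ[X] A
  obtain ⟨d, hd⟩ := exists_forall_exists_natDegree_le_aeval_eq_zero ℂ[X] A
  refine ⟨d, fun y => ?_⟩
  obtain ⟨P, hP, hPd, hPy⟩ := hd (Ideal.Quotient.mk I y)
  refine ⟨P, hP, hPd, fun x hx => ?_⟩
  let ev : A →+* ℂ := Ideal.Quotient.lift I (MvPolynomial.eval x) fun p hp => by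
    simpa using hp x hx
  have h := congrArg ev hPy
  rw [map_zero, aeval_def, hom_eval₂] at h
  rw [eval_map]
  convert! h using 1
  congr 1
  ext c
  · have : algebraMap ℂ[X] A (Polynomial.C c) = Ideal.Quotient.mk I (MvPolynomial.C c) := aeval_C _ c
    simp only [coe_evalRingHom, eval_C, RingHom.comp_apply, this]
    exact (MvPolynomial.eval_C c).symm
  · have : algebraMap ℂ[X] A X = Ideal.Quotient.mk I f := aeval_X _
    simp only [coe_evalRingHom, eval_X, RingHom.comp_apply, this]
    rfl

theorem MvPolynomial.exists_forall_eval_eq_linearMap {R σ : Type*} [CommSemiring R] [Fintype σ]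
    [DecidableEq σ] (z : (σ → R) →ₗ[R] R) :
    ∃ f : MvPolynomial σ R, ∀ x, MvPolynomial.eval x f = z x := by
  refine ⟨∑ i, MvPolynomial.C (z (Pi.single i 1)) * MvPolynomial.X i, fun x => ?_⟩
  conv_rhs => rw [pi_eq_sum_univ' x, map_sum]
  simp [mul_comm]

theorem IsProperMap.tendsto_norm_atTop {X : Type*} [TopologicalSpace X] {f : X → ℂ}
    (hf : IsProperMap f) : Tendsto (fun x => ‖f x‖) (cocompact X) atTop :=
  tendsto_norm_cocompact_atTop.comp (isProperMap_iff_tendsto_cocompact.mp hf).2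

theorem mainTheorem9 {n : ℕ} (C : Set (Fin n → ℂ)) (hC : IsAffineAlgebraicCurve C)
    (z : (Fin n → ℂ) →ₗ[ℂ] ℂ) (hz : IsProperMap (fun x : C => z (x : Fin n → ℂ))) :
    ∃ d : ℕ, 0 < d ∧
      ∀ (y : MvPolynomial (Fin n) ℂ) (γ : ℝ≥0 → C), IsProperMap γ →
        (∃ᶠ t in atTop, MvPolynomial.eval (γ t : Fin n → ℂ) y ≠ 0) →
        (∀ᶠ t in atTop, MvPolynomial.eval (γ t : Fin n → ℂ) y ≠ 0 ∧
          1 < ‖z (γ t : Fin n → ℂ)‖) ∧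
        ∃ a b : ℤ, a ≠ 0 ∧ |a| ≤ (d : ℤ) ∧
          Tendsto (fun t : ℝ≥0 => Real.log ‖MvPolynomial.eval (γ t : Fin n → ℂ) y‖ /
            Real.log ‖z (γ t : Fin n → ℂ)‖) atTop (𝓝 ((b : ℝ) / (a : ℝ))) := by
  obtain ⟨f, hf⟩ := MvPolynomial.exists_forall_eval_eq_linearMap z
  obtain ⟨d, hd⟩ := hC.exists_forall_exists_relation f
  -- The rank bound d is not known to be positive here.
  refine ⟨d + 1, d.succ_pos, fun y γ hγ hfreq => ?_⟩
  obtain ⟨P, hP, hPd, hPC⟩ := hd y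
  simp only [hf] at hPC
  have hzγ : IsProperMap (fun t => z (γ t : Fin n → ℂ)) := hz.comp hγ
  have hzlim : Tendsto (fun t => ‖z (γ t : Fin n → ℂ)‖) atTop atTop := by
    simpa only [cocompact_eq_atTop] using hzγ.tendsto_norm_atTop
  have hyc : Continuous fun t => MvPolynomial.eval (γ t : Fin n → ℂ) y :=
    y.continuous_eval.comp (continuous_subtype_val.comp hγ.continuous)
  -- Write P = X^k Q with Q(0) ≠ 0. If y and Q(z, y) both vanish, z is a root of the constant
  -- coefficient of Q, which is impossible once |z| is large.
  obtain ⟨Q, hPQ, hQ⟩ := P.exists_eq_pow_rootMultiplicity_mul_and_not_dvd hP 0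
  rw [Polynomial.C_0, sub_zero] at hPQ hQ
  have hQ0 : Q ≠ 0 := fun h => hQ (h ▸ dvd_zero _)
  have hQd : Q.natDegree ≤ d :=
    (Polynomial.natDegree_le_of_dvd (hPQ ▸ dvd_mul_left _ _) hP).trans hPd
  have hQ00 : Q.coeff 0 ≠ 0 := fun h => hQ (Polynomial.X_dvd_iff.mpr h)
  let g : ℝ≥0 → ℂ := fun t => (Q.map (Polynomial.evalRingHom (z (γ t : Fin n → ℂ)))).eval
    (MvPolynomial.eval (γ t : Fin n → ℂ) y)
  have hg : Continuous g := by
    have : g = fun t => ∑ i ∈ Q.support, (Q.coeff i).eval (z (γ t : Fin n → ℂ)) *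
        MvPolynomial.eval (γ t : Fin n → ℂ) y ^ i := by
      ext t
      simp [g, Polynomial.eval_map, Polynomial.eval₂_eq_sum, Polynomial.sum]
    rw [this]
    exact continuous_finsetSum _ fun i _ =>
      ((Q.coeff i).continuous.comp hzγ.continuous).mul (hyc.pow i)
  have hor : ∀ t, MvPolynomial.eval (γ t : Fin n → ℂ) y = 0 ∨ g t = 0 := by
    intro t
    have h := hPC _ (γ t).2
    rw [hPQ, Polynomial.map_mul, Polynomial.eval_mul, Polynomial.map_pow, Polynomial.map_X,
      Polynomial.eval_pow, Polynomial.eval_X, mul_eq_zero] at h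
    exact h.imp_left eq_zero_of_pow_eq_zero
  have hnot : ∀ᶠ t in atTop, ¬ (MvPolynomial.eval (γ t : Fin n → ℂ) y = 0 ∧ g t = 0) := by
    obtain ⟨B, hB⟩ :=
      Polynomial.exists_eventually_abs_log_norm_eval_sub_le hQ00 hzlim
    filter_upwards [hB] with t ht ⟨h1, h2⟩
    simp only [g, h1, ← Polynomial.coeff_zero_eq_eval_zero, Polynomial.coeff_map] at h2
    exact ht.1 h2
  have hg0 : ∀ᶠ t in atTop, g t = 0 :=
    (eventually_or_eventually_of_continuousOn hyc hg (.of_forall hor) hnot).resolve_left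
      fun h => hfreq (h.mono fun t ht => not_not.mpr ht)
  have hy0 : ∀ᶠ t in atTop, MvPolynomial.eval (γ t : Fin n → ℂ) y ≠ 0 := by
    filter_upwards [hnot, hg0] with t h1 h2 h3 using h1 ⟨h3, h2⟩
  refine ⟨hy0.and (hzlim.eventually_gt_atTop 1), ?_⟩
  obtain ⟨a, b, ha, had, hlim⟩ := Polynomial.exists_tendsto_log_norm_div_log_norm hQ0
    hzγ.continuous hyc hzlim hy0 hg0
  exact ⟨a, b, ha, by push_cast; omega, hlim⟩
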